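/- **Setting.** Let $G=\langle a,b,c,d\mid abABcdCD=1\rangle$ be the genus-2 surface group, where a capital letter is the inverse of the small one, let $\Omega=\{a,b,c,d,A,B,C,D\}$, and write $\bar x$ for the inverse of $x$. The eight edges leaving a vertex of the (planar) Cayley graph $\Gamma$ are, in counterclockwise order, $a,d,C,D,c,b,A,B$. Let $x^-$ and $x^+$ be the neighbours of $x$ clockwise and counterclockwise in this cyclic order. For $1\le m\le 7$ let $t_m(x)$ be the $m$-th edge clockwise from $\bar x$ (so after traversing $x$ the possible continuations are, from left to right, $t_1(x),\dots,t_7(x)$), and let $x'=t_1(x)$ (the next edge of the octagon to the left of $x$). **The Markov chain.** The alphabet $\mathbb A$ consists of 88 states: $A_x$, $A'^{L}_x,A'^{R}_x,A''^{L}_x,A''^{R}_x$ for $x\in\Omega$; the states $B_{jk},C_{jk},C'_{jk},D_{jk}$, eight of each type, where $j$ (left) and $k$ (right) are the first, second, third, respectively fourth edges of the two paths of length 4 around an octagon of $\Gamma$ from a vertex to the opposite one (the right edge $k\in\Omega$ is arbitrary and determines $j$; write $B_{*k}$ etc.); and $E^L_{xyz}$ (with $x=y^+$, $z'=\bar y$)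 and $E^R_{xyz}$ (with $x=\overline{y'}$, $z=y^-$) for $y\in\Omega$. In particular $B_{*k}=B_{k^+k}$ and $D_{*k}=D_{\overline{k'}\,k}$. The allowed transitions are (with $t_m=t_m(x)$, respectively $t_m=t_m(k)$ for $D_{*k}$): * $A_x\to A'^L_{t_1},\ A_{t_2},\dots,A_{t_6},\ A'^R_{t_7},\ B_{*t_2},\dots,B_{*t_7}$; * $A'^L_x\to$ the same list with $A'^L_{t_1}$ replaced by $A''^L_{t_1}$; $A'^R_x\to$ the same list as for $A_x$ with $A'^R_{t_7}$ replaced by $A''^R_{t_7}$; * $A''^L_x\to A_{t_2},\dots,A_{t_6},\ A'^R_{t_7},\ B_{*t_3},\dots,B_{*t_7}$; $A''^R_x\to A'^L_{t_1},\ A_{t_2},\dots,A_{t_6},\ B_{*t_2},\dots,B_{*t_6}$; * $B_{*k}\to C_{*k'}$; $C_{*k}\to C'_{*k'}$; $C'_{*k}\to D_{*k'}$, or $E^L$ with middle edge $\overline{k''}$, where $k''=(k')'$, or $E^R$ with middle edge $k'$; * $D_{*k}\to A'^L_{t_2},\ A_{t_3},\dots,A_{t_6},\ A'^R_{t_7},\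 B_{*t_3},\dots,B_{*t_7}$; * $E^L_{xyz}\to C_{*y'}$; $E^R_{xyz}\to C_{*z'}$. Let $\mathbb J_n$ be the (finite, nonempty) set of bi-infinite sequences $\mathbf x=(x_m)_{m\in\mathbb Z}$ in $\mathbb A$ all of whose transitions $x_m\to x_{m+1}$ are allowed and with $x_{m+n}=x_m$ for all $m$. Let $\lambda_n$ be the uniform probability measure on $\mathbb J_n$, and $(\sigma\mathbf x)_m=x_{m+1}$. **The kernels.** Let $\phi$ map $A_x,A'^{L}_x,A'^{R}_x,A''^{L}_x,A''^{R}_x\mapsto\alpha_x$; $B_{jk}\mapsto\beta_{jk}$; $C_{jk},C'_{jk}\mapsto\gamma$; $D_{jk}\mapsto\delta_{jk}$; $E^L_{xyz}\mapsto\epsilon_y$; $E^R_{xyz}\mapsto\epsilon_{\bar y}$ (applied letterwise to sequences). Put $\overline{\alpha_x}=\alpha_{\bar x}$, $\overline{\beta_{xy}}=\delta_{\bar y\bar x}$, $\overline\gamma=\gamma$, $\overline{\delta_{xy}}=\beta_{\bar y\bar x}$, $\overline{\epsilon_x}=\epsilon_{\bar x}$. Consider the cyclic orders $$O_1=\alpha_a\beta_{da}\alpha_d\beta_{Cd}\alpha_C\beta_{DC}\alpha_D\beta_{cD}\alpha_c\beta_{bc}\alpha_b\beta_{Ab}\alpha_A\beta_{BA}\alpha_B\beta_{aB},$$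 $$O_2=\delta_{AD}\epsilon_A\delta_{Ba}\epsilon_B\delta_{ab}\epsilon_a\delta_{bA}\epsilon_b\delta_{CB}\epsilon_C\delta_{Dc}\epsilon_D\delta_{cd}\epsilon_c\delta_{dC}\epsilon_d .$$ For a cyclic word $w$ let $o_i(w)=1$ if its letters are distinct, lie in $O_i$ and occur in the cyclic order of $O_i$; $o_i(w)=-1$ if they do so in the reverse cyclic order; and $o_i(w)=0$ otherwise. For sequences $\zeta,\xi$ and $k\ge1$ set $u_k(\zeta,\xi)=0$ unless $\zeta_1\ne\xi_1$, $\zeta_k\neq\xi_k$ and $\zeta_m=\xi_m$ for $1<m<k$. If these conditions hold, set $u_k(\zeta,\xi)=1$ in the following cases and $0$ otherwise: * $k=1$ and $\{\zeta_1,\xi_1\}=\{\alpha_x,\epsilon_x\}$ for some $x\in\Omega$; * $k=2$ and $o_1(\overline{\zeta_1}\,\overline{\xi_1}\,\zeta_2\,\xi_2)=1$; * $k=3$ and $o_1(\overline{\zeta_1}\,\overline{\xi_1}\,\zeta_2)=o_1(\overline{\zeta_2}\,\zeta_3\,\xi_3)\ne0$; * $k=4$ and either $o_1(\overline{\zeta_1}\,\overline{\xi_1}\,\zeta_2)=o_1(\overline{\zeta_3}\,\zeta_4\,\xi_4)\neq0$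 or $o_2(\overline{\zeta_1}\,\overline{\xi_1}\,\zeta_4\,\xi_4)=1$; * $k\ge5$ and $o_1(\overline{\zeta_1}\,\overline{\xi_1}\,\zeta_2)+o_2(\overline{\zeta_1}\,\overline{\xi_1}\,\zeta_4)=o_1(\overline{\zeta_{k-1}}\,\zeta_k\,\xi_k)+o_2(\overline{\zeta_{k-3}}\,\zeta_k\,\xi_k)\ne0$. Let $v_k(\zeta,\xi)=u_k(\zeta_1\cdots\zeta_k,\ \overline{\xi_k}\cdots\overline{\xi_1})$ and $h_k(\mathbf x,\mathbf y)=u_k(\phi(\mathbf x),\phi(\mathbf y))+v_k(\phi(\mathbf x),\phi(\mathbf y))$. **Theorem.** There exist constants $C<\infty$ and $0<\theta<1$ such that for all $n\ge k\ge1$ and $0\le i<j<n$, $$E_{\lambda_n}\bigl|h_k(\sigma^i\mathbf x,\sigma^j\mathbf x)\bigr|\le C\theta^k .$$ -/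

import Mathlib

namespace Snake

/-- The set `Ω` of generators of `⟨a,b,c,d | abABcdCD = 1⟩` and their inverses;
a capital letter is the inverse of the corresponding small letter. -/
inductive Letter
  | a | b | c | d | A | B | C | D
  deriving DecidableEq

instance : Fintype Letter where
  elems := {.a, .b, .c, .d, .A, .B, .C, .D}
  complete x := by cases x <;> decide

/-- `x̄`, the inverse of a letter. -/
def Letter.inv : Letter → Letter
  | .a => .A | .b => .B | .c => .C | .d => .D
  | .A => .a | .B => .b | .C => .c | .D => .d

/-- The eight edges of the Cayley graph leaving a vertex are, counterclockwise,
`a, d, C, D, c, b, A, B`.  `cw x` is the next outgoing edge clockwise from `x`. -/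
def Letter.cw : Letter → Letter
  | .a => .B | .B => .A | .A => .b | .b => .c
  | .c => .D | .D => .C | .C => .d | .d => .a

/-- `ccw x` is the next outgoing edge counterclockwise from `x`. -/
def Letter.ccw : Letter → Letter
  | .a => .d | .d => .C | .C => .D | .D => .c
  | .c => .b | .b => .A | .A => .B | .B => .a

/-- After traversing an edge `x`, the seven edges on which one can leave the end vertex
without backtracking are, from left to right, `turn 1 x, …, turn 7 x`. -/
def Letter.turn (m : ℕ) (x : Letter) : Letter := Letter.cw^[m] x.inv

/-- The edge that follows `x` on the boundary of the octagon to the left of `x`.  Iterating it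
reads off the relation `a, b, A, B, c, d, C, D` cyclically. -/
def Letter.next (x : Letter) : Letter := x.turn 1

inductive Side
  | L | R
  deriving DecidableEq

instance : Fintype Side where
  elems := {.L, .R}
  complete x := by cases x <;> decide

/-- The 88 Markov states.  A state is a step of a snake (the edges traversed in this step)
together with the type of the region of possible continuations.

* `A x`, `A' s x`, `A'' s x`: the single edge `x` is traversed; for `A'` and `A''` the superscript
  `s` is the side on which the region has been cut.
* `B k`, `C k`, `C' k`, `D k`: the states `B_{jk}`, `C_{jk}`, `C'_{jk}`, `D_{jk}`.  The two edges
  `j` (left) and `k` (right) are the first, second, third, respectively fourth edges of the two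
  paths of length four around an octagon from a vertex to the opposite vertex.  The right-hand
  edge `k` determines the left-hand edge `j`.
* `E s y`: the states `E^s_{xyz}`, with middle edge `y`.  For `s = L`, `y` starts at the start of
  the left edge `x` (so `x = y.ccw`) and ends at the end of the right edge `z`; for `s = R`, `y`
  starts at the start of `z` (so `z = y.cw`) and ends at the end of `x`.  -/
inductive State
  | A (x : Letter)
  | A' (s : Side) (x : Letter)
  | A'' (s : Side) (x : Letter)
  | B (k : Letter)
  | C (k : Letter)
  | C' (k : Letter)
  | D (k : Letter)
  | E (s : Side) (y : Letter)
  deriving DecidableEq, Fintype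

open Letter Side

/-- The states that may follow a given state, i.e. the subregions into which its region is
divided by the geodesics bounding the next octagon(s). A pair of adjacent outgoing edges
`(turn m x, turn (m+1) x)` starts a `B`-state with right-hand edge `turn (m+1) x`. -/
def succ : State → List State
  | .A x =>
      [.A' L (turn 1 x), .A (turn 2 x), .A (turn 3 x), .A (turn 4 x), .A (turn 5 x),
        .A (turn 6 x), .A' R (turn 7 x),
        .B (turn 2 x), .B (turn 3 x), .B (turn 4 x), .B (turn 5 x), .B (turn 6 x), .B (turn 7 x)]
  | .A' L x =>
      [.A'' L (turn 1 x), .A (turn 2 x), .A (turn 3 x), .A (turn 4 x), .A (turn 5 x),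
        .A (turn 6 x), .A' R (turn 7 x),
        .B (turn 2 x), .B (turn 3 x), .B (turn 4 x), .B (turn 5 x), .B (turn 6 x), .B (turn 7 x)]
  | .A' R x =>
      [.A' L (turn 1 x), .A (turn 2 x), .A (turn 3 x), .A (turn 4 x), .A (turn 5 x),
        .A (turn 6 x), .A'' R (turn 7 x),
        .B (turn 2 x), .B (turn 3 x), .B (turn 4 x), .B (turn 5 x), .B (turn 6 x), .B (turn 7 x)]
  | .A'' L x =>
      [.A (turn 2 x), .A (turn 3 x), .A (turn 4 x), .A (turn 5 x), .A (turn 6 x),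
        .A' R (turn 7 x),
        .B (turn 3 x), .B (turn 4 x), .B (turn 5 x), .B (turn 6 x), .B (turn 7 x)]
  | .A'' R x =>
      [.A' L (turn 1 x), .A (turn 2 x), .A (turn 3 x), .A (turn 4 x), .A (turn 5 x),
        .A (turn 6 x),
        .B (turn 2 x), .B (turn 3 x), .B (turn 4 x), .B (turn 5 x), .B (turn 6 x)]
  | .B k => [.C k.next]
  | .C k => [.C' k.next]
  | .C' k => [.D k.next, .E L k.next.next.inv, .E R k.next]
  -- the two incoming edges of `D k` are `k` and, to its left, the inverse of `turn 1 k`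
  | .D k =>
      [.A' L (turn 2 k), .A (turn 3 k), .A (turn 4 k), .A (turn 5 k), .A (turn 6 k),
        .A' R (turn 7 k),
        .B (turn 3 k), .B (turn 4 k), .B (turn 5 k), .B (turn 6 k), .B (turn 7 k)]
  | .E L y => [.C y.next]
  | .E R y => [.C y.cw.next]

/-- The spine alphabet `Φ`. Only the pairs `xy` that occur in the image of `spine` matter. -/
inductive Spine
  | α (x : Letter)
  | β (x y : Letter)
  | γ
  | δ (x y : Letter)
  | ε (x : Letter)
  deriving DecidableEq, Fintype

/-- The letter map `φ` from Markov states to the spine alphabet. -/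
def spine : State → Spine
  | .A x => .α x
  | .A' _ x => .α x
  | .A'' _ x => .α x
  | .B k => .β k.ccw k
  | .C _ => .γ
  | .C' _ => .γ
  | .D k => .δ k.next.inv k
  | .E L y => .ε y
  | .E R y => .ε y.inv

/-- Inverses in the spine alphabet. -/
def Spine.bar : Spine → Spine
  | .α x => .α x.inv
  | .β x y => .δ y.inv x.inv
  | .γ => .γ
  | .δ x y => .β y.inv x.inv
  | .ε x => .ε x.inv

/-- Counterclockwise cyclic order of the spine edges leaving a vertex of the Cayley graph. -/
def O₁ : List Spine :=
  [.α .a, .β .d .a, .α .d, .β .C .d, .α .C, .β .D .C, .α .D, .β .c .D,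
    .α .c, .β .b .c, .α .b, .β .A .b, .α .A, .β .B .A, .α .B, .β .a .B]

/-- Counterclockwise cyclic order of the spine edges leaving the center of an octagon of the
Cayley graph. -/
def O₂ : List Spine :=
  [.δ .A .D, .ε .A, .δ .B .a, .ε .B, .δ .a .b, .ε .a, .δ .b .A, .ε .b,
    .δ .C .B, .ε .C, .δ .D .c, .ε .D, .δ .c .d, .ε .c, .δ .d .C, .ε .d]

/-- Orientation of a cyclic word `w` with respect to the cyclic order `O` (a list without
repetitions): `1` if its letters occur in cyclic order in `O`, `-1` if they occur in reverse
cyclic order, `0` otherwise. -/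
def orient (O w : List Spine) : ℤ :=
  if ∃ r < O.length, List.Sublist w (O.rotate r) then 1
  else if ∃ r < O.length, List.Sublist w.reverse (O.rotate r) then -1
  else 0

/-- The condition for `u_k (ζ, ξ) = 1`, apart from condition (b). -/
def Linked (ζ ξ : ℤ → Spine) : ℕ → Prop
  | 0 => False
  | 1 => ∃ x : Letter, (ζ 1 = .α x ∧ ξ 1 = .ε x) ∨ (ζ 1 = .ε x ∧ ξ 1 = .α x)
  | 2 => orient O₁ [(ζ 1).bar, (ξ 1).bar, ζ 2, ξ 2] = 1
  | 3 => orient O₁ [(ζ 1).bar, (ξ 1).bar, ζ 2] = orient O₁ [(ζ 2).bar, ζ 3, ξ 3] ∧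
      orient O₁ [(ζ 2).bar, ζ 3, ξ 3] ≠ 0
  | 4 => (orient O₁ [(ζ 1).bar, (ξ 1).bar, ζ 2] = orient O₁ [(ζ 3).bar, ζ 4, ξ 4] ∧
        orient O₁ [(ζ 3).bar, ζ 4, ξ 4] ≠ 0) ∨
      orient O₂ [(ζ 1).bar, (ξ 1).bar, ζ 4, ξ 4] = 1
  | m + 5 =>
      let k : ℤ := (m : ℤ) + 5
      orient O₁ [(ζ 1).bar, (ξ 1).bar, ζ 2] + orient O₂ [(ζ 1).bar, (ξ 1).bar, ζ 4] =
          orient O₁ [(ζ (k - 1)).bar, ζ k, ξ k] + orient O₂ [(ζ (k - 3)).bar, ζ k, ξ k] ∧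
        orient O₁ [(ζ (k - 1)).bar, ζ k, ξ k] + orient O₂ [(ζ (k - 3)).bar, ζ k, ξ k] ≠ 0

open Classical in
/-- `u_k` on doubly infinite strings; only the entries with indices `1, …, k` are used. -/
noncomputable def u (k : ℕ) (ζ ξ : ℤ → Spine) : ℤ :=
  if (ζ 1 ≠ ξ 1 ∧ ζ k ≠ ξ k ∧ ∀ m : ℤ, 1 < m → m < k → ζ m = ξ m) ∧ Linked ζ ξ k then 1 else 0

/-- `v_k (ζ, ξ) = u_k (ζ₁ ζ₂ … ζ_k, ξ̄_k … ξ̄₂ ξ̄₁)`. -/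
noncomputable def v (k : ℕ) (ζ ξ : ℤ → Spine) : ℤ :=
  u k ζ (fun m => (ξ (k + 1 - m)).bar)

/-- The linked-pair kernel `h_k`. -/
noncomputable def h (k : ℕ) (x y : ℤ → State) : ℤ :=
  u k (spine ∘ x) (spine ∘ y) + v k (spine ∘ x) (spine ∘ y)

/-- `σ^i`. -/
def shift (i : ℕ) (x : ℤ → State) : ℤ → State := fun m => x (m + i)

/-- The set `𝕁_n` of elements of the two-sided topological Markov chain that have period `n`. -/
def J (n : ℕ) : Set (ℤ → State) :=
  {x | (∀ m, x (m + 1) ∈ succ (x m)) ∧ ∀ m, x (m + n) = x m}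

theorem J_finite {n : ℕ} (hn : 1 ≤ n) : (J n).Finite := by
  have hn' : (0 : ℤ) < n := by exact_mod_cast hn
  refine Set.Finite.of_injOn (f := fun (x : ℤ → State) (i : Fin n) => x (i : ℕ))
    (t := Set.univ) (fun _ _ => Set.mem_univ _) ?_ Set.finite_univ
  intro x hx y hy hxy
  have key : ∀ z ∈ J n, ∀ m : ℤ, z m = z (m % n) := by
    intro z hz m
    have hp : Function.Periodic z (n : ℤ) := hz.2
    have h1 := hp.int_mul (m / n) (m % n)
    have h2 : m % n + ((m / n : ℤ) : ℤ) * n = m := by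
      rw [mul_comm]; exact Int.emod_add_mul_ediv m n
    simp only [Int.cast_id] at h1
    rwa [h2] at h1
  funext m
  rw [key x hx m, key y hy m]
  have h0 := Int.emod_nonneg m hn'.ne'
  have h1 := Int.emod_lt_of_pos m hn'
  have h2 := congrFun hxy ⟨(m % n).toNat, by omega⟩
  simpa [Int.toNat_of_nonneg h0] using h2

theorem J_nonempty (n : ℕ) : (J n).Nonempty :=
  by
  have h : State.A .a ∈ succ (.A .a) := by decide
  exact ⟨fun _ => .A .a, fun _ => h, fun _ => rfl⟩

/-- Expectation with respect to the uniform probability measure `λ_n` on `𝕁_n` (`n ≥ 1`). -/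
noncomputable def expect (n : ℕ) (f : (ℤ → State) → ℝ) : ℝ :=
  (∑ᶠ x ∈ J n, f x) / (J n).ncard

end Snake

/-! The geometry of linking plays no role: a nonzero `u k` or `v k` already forces one stretch of
the spine of `x` to repeat another stretch, or to be the inverse of another stretch read backwards.
After passing to a quarter of the stretch and choosing a starting point on the cycle of length `n`,
each spine letter of a block is then a function of one earlier letter (`exists_predicted_of_shift`,
`exists_predicted_of_reflection`).

Such prediction is exponentially rare. The chain is primitive (`exists_forall_hasWalk`), and from
any state two suitable steps lead to a genuine choice of the next spine letter (`exists_branching`).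
So `Q + 2` consecutive states can be rewritten to violate a prediction and then rejoin the old
sequence (`exists_splice`). Recording the erased states makes this surgery injective, so each
further block of `Q + 2` predictions retains at most a fraction `1 - 1 / K` of the sequences, where
`K` is the number of words of length `Q + 2` (`ncard_predicted_le`). -/

namespace Snake

open Letter Side

/-! ### Walks, primitivity and branching of the chain -/

/-- `t` may follow `s`. -/
def Step (s t : State) : Prop := t ∈ succ s

/-- There is a walk of length `n` from `s` to `t`. -/
def HasWalk (n : ℕ) (s t : State) : Prop :=
  ∃ z : ℕ → State, z 0 = s ∧ z n = t ∧ ∀ e < n, Step (z e) (z (e + 1))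

theorem HasWalk.refl (s : State) : HasWalk 0 s s := ⟨fun _ => s, rfl, rfl, by simp⟩

theorem HasWalk.trans {m n : ℕ} {s t r : State} (h₁ : HasWalk m s t) (h₂ : HasWalk n t r) :
    HasWalk (m + n) s r := by
  obtain ⟨z, hz0, hzm, hz⟩ := h₁
  obtain ⟨w, hw0, hwn, hw⟩ := h₂
  refine ⟨fun e => if e ≤ m then z e else w (e - m), by simp [hz0], ?_, ?_⟩
  · by_cases hn : n = 0
    · subst hn
      simp [hzm, ← hw0, hwn]
    · have : ¬ m + n ≤ m := by omega
      simp [this, hwn]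
  · intro e he
    rcases lt_trichotomy e m with h | h | h
    · simpa [h.le, Nat.succ_le_of_lt h] using hz e h
    · subst h
      have := hw 0 (by omega)
      simpa [hzm, hw0] using this
    · have h1 : ¬ e ≤ m := by omega
      have h2 : ¬ e + 1 ≤ m := by omega
      have h3 : e + 1 - m = e - m + 1 := by omega
      simpa [h1, h2, h3] using hw (e - m) (by omega)

theorem Step.hasWalk {s t : State} (h : Step s t) : HasWalk 1 s t :=
  ⟨fun e => if e = 0 then s else t, by simp, by simp, by
    intro e he
    obtain rfl : e = 0 := by omega
    simpa using h⟩

theorem exists_hasWalk_of_reflTransGen {s t : State} (h : Relation.ReflTransGen Step s t) :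
    ∃ n, HasWalk n s t := by
  induction h with
  | refl => exact ⟨0, .refl _⟩
  | tail _ h ih =>
    obtain ⟨n, hn⟩ := ih
    exact ⟨n + 1, hn.trans h.hasWalk⟩

/-- One step does not suffice, since only the turns 2 to 6 lead from an `A`-state to an `A`-state;
two steps always do. -/
theorem reach_A_A (x y : Letter) : Relation.ReflTransGen Step (.A x) (.A y) := by
  have key : ∀ x y : Letter, ∃ z, State.A z ∈ succ (.A x) ∧ State.A y ∈ succ (.A z) := by
    decide +kernel
  obtain ⟨z, h₁, h₂⟩ := key x y
  exact .tail (.single h₁) h₂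

theorem reach_A (s : State) : Relation.ReflTransGen Step s (.A .a) := by
  suffices h : ∃ x, Relation.ReflTransGen Step s (.A x) by
    obtain ⟨x, hx⟩ := h
    exact hx.trans (reach_A_A x .a)
  have hD (k : Letter) : Relation.ReflTransGen Step (.D k) (.A (turn 3 k)) :=
    .single (by simp [Step, succ])
  have hC' (k : Letter) : Relation.ReflTransGen Step (.C' k) (.A (turn 3 k.next)) :=
    .head (b := .D k.next) (by simp [Step, succ]) (hD _)
  have hC (k : Letter) : Relation.ReflTransGen Step (.C k) (.A (turn 3 k.next.next)) :=
    .head (b := .C' k.next) (by simp [Step, succ]) (hC' _)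
  rcases s with x | ⟨_ | _, x⟩ | ⟨_ | _, x⟩ | k | k | k | k | ⟨_ | _, y⟩
  · exact ⟨x, .refl⟩
  · exact ⟨turn 3 x, .single (by simp [Step, succ])⟩
  · exact ⟨turn 3 x, .single (by simp [Step, succ])⟩
  · exact ⟨turn 3 x, .single (by simp [Step, succ])⟩
  · exact ⟨turn 3 x, .single (by simp [Step, succ])⟩
  · exact ⟨_, .head (b := .C k.next) (by simp [Step, succ]) (hC _)⟩
  · exact ⟨_, hC k⟩
  · exact ⟨_, hC' k⟩
  · exact ⟨_, hD k⟩
  · exact ⟨_, .head (b := .C y.next) (by simp [Step, succ]) (hC _)⟩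
  · exact ⟨_, .head (b := .C y.cw.next) (by simp [Step, succ]) (hC _)⟩

theorem reach_from_A (t : State) : Relation.ReflTransGen Step (.A .a) t := by
  have hnext : ∀ k : Letter, ∃ l : Letter, l.next = k := by decide
  have hB (k : Letter) : Relation.ReflTransGen Step (.A .a) (.B k) := by
    have key : ∀ k, ∃ x, State.B k ∈ succ (.A x) := by decide +kernel
    obtain ⟨x, hx⟩ := key k
    exact (reach_A_A .a x).tail hx
  have hC (k : Letter) : Relation.ReflTransGen Step (.A .a) (.C k) := by
    obtain ⟨l, rfl⟩ := hnext k
    exact (hB l).tail (by simp [Step, succ])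
  have hC' (k : Letter) : Relation.ReflTransGen Step (.A .a) (.C' k) := by
    obtain ⟨l, rfl⟩ := hnext k
    exact (hC l).tail (by simp [Step, succ])
  have hA' (s : Side) (x : Letter) : Relation.ReflTransGen Step (.A .a) (.A' s x) := by
    have key : ∀ s x, ∃ z, State.A' s x ∈ succ (.A z) := by decide +kernel
    obtain ⟨z, hz⟩ := key s x
    exact (reach_A_A .a z).tail hz
  rcases t with x | ⟨s, x⟩ | ⟨s, x⟩ | k | k | k | k | ⟨s, y⟩
  · exact reach_A_A .a x
  · exact hA' s x
  · have key : ∀ s x, ∃ z, State.A'' s x ∈ succ (.A' s z) := by decide +kernel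
    obtain ⟨z, hz⟩ := key s x
    exact (hA' s z).tail hz
  · exact hB k
  · exact hC k
  · exact hC' k
  · obtain ⟨l, rfl⟩ := hnext k
    exact (hC' l).tail (by simp [Step, succ])
  · have key : ∀ s y, ∃ k, State.E s y ∈ succ (.C' k) := by decide +kernel
    obtain ⟨k, hk⟩ := key s y
    exact (hC' k).tail hk

/-- The sixth turn after `a` is `a` itself. This self-loop allows walks through `.A .a` to be padded
to a common length. -/
theorem hasWalk_loop (n : ℕ) : HasWalk n (.A .a) (.A .a) :=
  ⟨fun _ => .A .a, rfl, rfl, fun _ _ => by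
    show State.A .a ∈ succ (.A .a)
    decide⟩

/-- The transition matrix is primitive. -/
theorem exists_forall_hasWalk : ∃ Q, 1 ≤ Q ∧ ∀ s t : State, HasWalk Q s t := by
  choose f hf using fun s => exists_hasWalk_of_reflTransGen (reach_A s)
  choose g hg using fun t => exists_hasWalk_of_reflTransGen (reach_from_A t)
  refine ⟨1 + Finset.univ.sup f + Finset.univ.sup g, by omega, fun s t => ?_⟩
  have h₁ : f s ≤ Finset.univ.sup f := Finset.le_sup (Finset.mem_univ s)
  have h₂ : g t ≤ Finset.univ.sup g := Finset.le_sup (Finset.mem_univ t)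
  have := ((hf s).trans (hasWalk_loop
    (1 + Finset.univ.sup f + Finset.univ.sup g - f s - g t))).trans (hg t)
  convert this using 1
  omega

/-- Two steps after any state one can be at a state whose successors do not all have the same
spine letter. -/
theorem exists_branching (s : State) : ∃ z₁ z₂ z₃ z₃' : State,
    Step s z₁ ∧ Step z₁ z₂ ∧ Step z₂ z₃ ∧ Step z₂ z₃' ∧ spine z₃ ≠ spine z₃' := by
  have hA (x : Letter) : ∃ z₃ z₃', Step (.A x) z₃ ∧ Step (.A x) z₃' ∧ spine z₃ ≠ spine z₃' :=
    ⟨.A (turn 2 x), .B (turn 2 x), by simp [Step, succ], by simp [Step, succ], by simp [spine]⟩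
  have hD (k : Letter) : ∃ z₃ z₃', Step (.D k) z₃ ∧ Step (.D k) z₃' ∧ spine z₃ ≠ spine z₃' :=
    ⟨.A (turn 3 k), .B (turn 3 k), by simp [Step, succ], by simp [Step, succ], by simp [spine]⟩
  have hC' (k : Letter) :
      ∃ z₃ z₃', Step (.C' k) z₃ ∧ Step (.C' k) z₃' ∧ spine z₃ ≠ spine z₃' :=
    ⟨.D k.next, .E R k.next, by simp [Step, succ], by simp [Step, succ], by simp [spine]⟩
  suffices h : ∃ z₁ z₂, Step s z₁ ∧ Step z₁ z₂ ∧
      ∃ z₃ z₃', Step z₂ z₃ ∧ Step z₂ z₃' ∧ spine z₃ ≠ spine z₃' by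
    obtain ⟨z₁, z₂, h₁, h₂, z₃, z₃', h₃⟩ := h
    exact ⟨z₁, z₂, z₃, z₃', h₁, h₂, h₃⟩
  have hAA (x : Letter) : Step (.A x) (.A (turn 3 x)) := by simp [Step, succ]
  -- Two steps are needed because of `B`, whose continuation is forced up to `C'`; all other states
  -- can also be brought to an `A`-, `C'`- or `D`-state in exactly two.
  rcases s with x | ⟨_ | _, x⟩ | ⟨_ | _, x⟩ | k | k | k | k | ⟨_ | _, y⟩
  · exact ⟨.A (turn 3 x), _, by simp [Step, succ], hAA _, hA _⟩
  · exact ⟨.A (turn 3 x), _, by simp [Step, succ], hAA _, hA _⟩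
  · exact ⟨.A (turn 3 x), _, by simp [Step, succ], hAA _, hA _⟩
  · exact ⟨.A (turn 3 x), _, by simp [Step, succ], hAA _, hA _⟩
  · exact ⟨.A (turn 3 x), _, by simp [Step, succ], hAA _, hA _⟩
  · exact ⟨.C k.next, .C' k.next.next, by simp [Step, succ], by simp [Step, succ], hC' _⟩
  · exact ⟨.C' k.next, .D k.next.next, by simp [Step, succ], by simp [Step, succ], hD _⟩
  · exact ⟨.D k.next, .A (turn 3 k.next), by simp [Step, succ], by simp [Step, succ], hA _⟩
  · exact ⟨.A (turn 3 k), _, by simp [Step, succ], hAA _, hA _⟩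
  · exact ⟨.C y.next, .C' y.next.next, by simp [Step, succ], by simp [Step, succ], hC' _⟩
  · exact ⟨.C y.cw.next, .C' y.cw.next.next, by simp [Step, succ], by simp [Step, succ], hC' _⟩

/-! ### Surgery on periodic sequences -/

/-- Replace the entries of `x` at the positions `b + p, …, b + p + T - 1` modulo `n` by
`z 1, …, z T`. -/
def splice (n : ℕ) (b : ℤ) (p T : ℕ) (x : ℤ → State) (z : ℕ → State) : ℤ → State := fun m =>
  if p ≤ ((m - b) % n).toNat ∧ ((m - b) % n).toNat < p + T then z (((m - b) % n).toNat - p + 1)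
  else x m

theorem eq_of_mem_J {n : ℕ} {x : ℤ → State} (hx : x ∈ J n) (m c : ℤ) : x (m + c * n) = x m := by
  have hp : Function.Periodic x (n : ℤ) := hx.2
  simpa using hp.int_mul c m

theorem splice_apply {n : ℕ} {b : ℤ} {p T : ℕ} {x : ℤ → State} {z : ℕ → State} {e : ℕ}
    (he : e < n) : splice n b p T x z (b + e) =
      if p ≤ e ∧ e < p + T then z (e - p + 1) else x (b + e) := by
  have : ((b + e - b) % (n : ℤ)).toNat = e := by
    rw [add_sub_cancel_left, Int.emod_eq_of_lt (by omega) (by omega)]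
    simp
  simp only [splice, this]

/-- `z 0` and `z (T + 1)` are the unchanged neighbours of the replaced stretch, so the stretch
together with both junctions is a walk of `T + 1` steps. -/
theorem splice_mem_J {n : ℕ} {b : ℤ} {p T : ℕ} {x : ℤ → State} {z : ℕ → State}
    (hx : x ∈ J n) (hp : 1 ≤ p) (hpT : p + T ≤ n) (hz0 : z 0 = x (b + p - 1))
    (hzT : z (T + 1) = x (b + p + T)) (hz : ∀ e < T + 1, Step (z e) (z (e + 1))) :
    splice n b p T x z ∈ J n := by
  have hper : ∀ m c : ℤ, splice n b p T x z (m + c * n) = splice n b p T x z m := by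
    intro m c
    have : (m + c * n - b) % (n : ℤ) = (m - b) % n := by
      rw [show m + c * n - b = (m - b) + c * n by ring, Int.add_mul_emod_self_right]
    simp only [splice, this, eq_of_mem_J hx]
  have hstep : ∀ e < n, splice n b p T x z (b + e + 1) ∈ succ (splice n b p T x z (b + e)) := by
    intro e he
    have h1 : splice n b p T x z (b + e + 1) =
        if p ≤ e + 1 ∧ e + 1 < p + T then z (e + 1 - p + 1) else x (b + e + 1) := by
      by_cases hen : e + 1 < n
      · have := splice_apply (b := b) (p := p) (T := T) (x := x) (z := z) hen
        push_cast at this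
        rw [← add_assoc] at this
        exact this
      -- The successor of the last position of the period is `b + n`, identified with `b`, whose
      -- entry is unchanged because `1 ≤ p`.
      · have hen' : (e : ℤ) + 1 = n := by omega
        have h0 := splice_apply (b := b) (p := p) (T := T) (x := x) (z := z)
          (show 0 < n by omega)
        have h2 := hper b 1
        have h3 := eq_of_mem_J hx b 1
        rw [one_mul, ← hen', ← add_assoc] at h2 h3
        rw [h2, h3, if_neg (by omega)]
        simpa [show ¬ p = 0 by omega] using h0
    rw [h1, splice_apply he]
    by_cases hin : p ≤ e ∧ e < p + T
    · rw [if_pos hin]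
      by_cases hin' : e + 1 < p + T
      · rw [if_pos ⟨by omega, hin'⟩, show e + 1 - p + 1 = (e - p + 1) + 1 by omega]
        exact hz _ (by omega)
      · rw [if_neg (by omega)]
        have := hz (e - p + 1) (by omega)
        rw [show e - p + 1 + 1 = T + 1 by omega, hzT] at this
        rw [show b + e + 1 = b + p + T by omega]
        exact this
    · rw [if_neg hin]
      by_cases hin' : p = e + 1 ∧ 0 < T
      · rw [if_pos ⟨by omega, by omega⟩]
        have := hz 0 (by omega)
        rw [hz0, show b + p - 1 = b + e by omega] at this
        rwa [show e + 1 - p + 1 = 0 + 1 by omega]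
      · rw [if_neg (by omega)]
        exact hx.1 _
  refine ⟨fun m => ?_, fun m => by simpa using hper m 1⟩
  have hn : (0 : ℤ) < n := by omega
  have h0 := Int.emod_nonneg (m - b) hn.ne'
  have h1 := Int.emod_lt_of_pos (m - b) hn
  have h2 := hstep ((m - b) % n).toNat (by omega)
  rw [Int.toNat_of_nonneg h0] at h2
  have h3 := Int.emod_add_mul_ediv (m - b) n
  have h4 : m = b + (m - b) % n + ((m - b) / n) * n := by linarith
  have h5 := hper (b + (m - b) % n) ((m - b) / n)
  have h6 := hper (b + (m - b) % n + 1) ((m - b) / n)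
  rw [← h4] at h5
  rw [show b + (m - b) % n + 1 + (m - b) / n * n = m + 1 by linarith] at h6
  rwa [h5, h6]

/-! ### Counting sequences with predictable letters -/

/-- The elements of `J n` whose spine letters at the positions `b + p` with `q ≤ p < q + L` are
predicted, by means of `g`, by the spine letters at the positions `b + r p`. -/
def predicted (n : ℕ) (b : ℤ) (q L : ℕ) (r : ℕ → ℕ) (g : Spine → Spine) : Set (ℤ → State) :=
  {x | x ∈ J n ∧ ∀ p, q ≤ p → p < q + L → spine (x (b + p)) = g (spine (x (b + r p)))}

/-- Two steps reach a branching state, the third violates the prediction at `q + L + 2`, and a walk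
of length `Q` returns to `x`. The earlier predictions survive, since they involve only positions
before the splice. -/
theorem exists_splice {Q : ℕ} (hQ : 1 ≤ Q) (hwalk : ∀ s t : State, HasWalk Q s t)
    {n : ℕ} {b : ℤ} {q L : ℕ} {r : ℕ → ℕ} {g : Spine → Spine} (hq : 1 ≤ q)
    (hn : q + L + (Q + 2) ≤ n) (hr : ∀ p, q ≤ p → p < q + L + (Q + 2) → r p < p)
    {x : ℤ → State} (hx : x ∈ predicted n b q L r g) :
    ∃ z, splice n b (q + L) (Q + 2) x z ∈
      predicted n b q L r g \ predicted n b q (L + (Q + 2)) r g := by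
  obtain ⟨z₁, z₂, z₃, z₃', h₁, h₂, h₃, h₃', hne⟩ :=
    exists_branching (x (b + (q + L : ℕ) - 1))
  set p := q + L with hp
  -- The state at the predicting position after the surgery. As `r (p + 2) < p + 2`, it is fixed
  -- before the state `y` at `p + 2` is chosen.
  let w : State := if r (p + 2) < p then x (b + r (p + 2)) else if r (p + 2) = p then z₁ else z₂
  obtain ⟨y, hy, hyw⟩ : ∃ y, Step z₂ y ∧ spine y ≠ g (spine w) := by
    by_cases h : spine z₃ = g (spine w)
    · exact ⟨z₃', h₃', fun h' => hne (h.trans h'.symm)⟩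
    · exact ⟨z₃, h₃, h⟩
  obtain ⟨a, ha0, haQ, ha⟩ := hwalk y (x (b + p + (Q + 2 : ℕ)))
  let z : ℕ → State := fun e => match e with
    | 0 => x (b + (p : ℕ) - 1)
    | 1 => z₁
    | 2 => z₂
    | e + 3 => a e
  have hz : ∀ e < Q + 2 + 1, Step (z e) (z (e + 1)) := by
    intro e he
    match e with
    | 0 => exact h₁
    | 1 => exact h₂
    | 2 => simpa [z, ha0] using hy
    | e + 3 => exact ha e (by omega)
  refine ⟨z, ⟨splice_mem_J hx.1 (by omega) (by omega) rfl (by simpa [z] using haQ) hz, ?_⟩, ?_⟩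
  · intro p' h1 h2
    have h3 := hr p' h1 (by omega)
    rw [splice_apply (by omega), splice_apply (by omega), if_neg (by omega), if_neg (by omega)]
    exact hx.2 p' h1 (by omega)
  · rintro ⟨-, h⟩
    have h1 := h (p + 2) (by omega) (by omega)
    have h2 := hr (p + 2) (by omega) (by omega)
    rw [splice_apply (by omega), splice_apply (by omega), if_pos (by omega)] at h1
    apply hyw
    have h4 : z (p + 2 - p + 1) = y := by
      rw [show p + 2 - p + 1 = 0 + 3 by omega]
      exact ha0
    rw [h4] at h1
    rw [h1]
    congr 2
    rcases lt_trichotomy (r (p + 2)) p with h5 | h5 | h5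
    · rw [if_neg (by omega)]
      simp [w, h5]
    · rw [if_pos (by omega), h5]
      simp [w, h5, z]
    · rw [if_pos (by omega), show r (p + 2) - p + 1 = 2 by omega]
      simp [w, z, show ¬ r (p + 2) < p by omega, show ¬ r (p + 2) = p by omega]

theorem predicted_subset_J {n : ℕ} {b : ℤ} {q L : ℕ} {r : ℕ → ℕ} {g : Spine → Spine} :
    predicted n b q L r g ⊆ J n := fun _ h => h.1

theorem predicted_anti {n : ℕ} {b : ℤ} {q L L' : ℕ} {r : ℕ → ℕ} {g : Spine → Spine}
    (h : L ≤ L') : predicted n b q L' r g ⊆ predicted n b q L r g :=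
  fun _ hx => ⟨hx.1, fun p h1 h2 => hx.2 p h1 (by omega)⟩

/-- A sequence in `J n` is determined by a splice of it and by the entries replaced. -/
theorem eq_of_splice_eq {n : ℕ} {b : ℤ} {p T : ℕ} {x y : ℤ → State} {z w : ℕ → State}
    (hn : 0 < n) (hx : x ∈ J n) (hy : y ∈ J n)
    (h : splice n b p T x z = splice n b p T y w) (he : ∀ e < T, x (b + p + e) = y (b + p + e)) :
    x = y := by
  have key : ∀ e < n, x (b + e) = y (b + e) := by
    intro e hen
    by_cases hin : p ≤ e ∧ e < p + T
    · have := he (e - p) (by omega)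
      rwa [show b + p + ((e - p : ℕ) : ℤ) = b + e by omega] at this
    · have := congrFun h (b + e)
      rwa [splice_apply hen, splice_apply hen, if_neg hin, if_neg hin] at this
  funext m
  have hn' : (0 : ℤ) < n := by omega
  have h0 := Int.emod_nonneg (m - b) hn'.ne'
  have h1 := Int.emod_lt_of_pos (m - b) hn'
  have h2 := key ((m - b) % n).toNat (by omega)
  rw [Int.toNat_of_nonneg h0] at h2
  have h3 := Int.emod_add_mul_ediv (m - b) n
  have h4 : m = b + (m - b) % n + ((m - b) / n) * n := by linarith
  rw [h4, eq_of_mem_J hx, eq_of_mem_J hy, h2]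

/-- Surgery sends each sequence to one violating a new prediction; paired with the `Q + 2` erased
states it is injective. -/
theorem ncard_predicted_le_mul {Q : ℕ} (hQ : 1 ≤ Q) (hwalk : ∀ s t : State, HasWalk Q s t)
    {n : ℕ} {b : ℤ} {q L : ℕ} {r : ℕ → ℕ} {g : Spine → Spine} (hq : 1 ≤ q)
    (hn : q + L + (Q + 2) ≤ n) (hr : ∀ p, q ≤ p → p < q + L + (Q + 2) → r p < p) :
    (predicted n b q L r g).ncard ≤
      (predicted n b q L r g \ predicted n b q (L + (Q + 2)) r g).ncard *
        Fintype.card State ^ (Q + 2) := by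
  have hfin : (predicted n b q L r g).Finite := (J_finite (by omega)).subset predicted_subset_J
  have : Nonempty (ℕ → State) := ⟨fun _ => .A .a⟩
  choose! z hz using fun x (hx : x ∈ predicted n b q L r g) => exists_splice hQ hwalk hq hn hr hx
  have hcard : (Set.univ : Set (Fin (Q + 2) → State)).ncard = Fintype.card State ^ (Q + 2) := by
    rw [Set.ncard_univ, Nat.card_eq_fintype_card]
    simp
  rw [← hcard, ← Set.ncard_prod]
  refine Set.ncard_le_ncard_of_injOn
    (fun x => (splice n b (q + L) (Q + 2) x (z x),
      fun e : Fin (Q + 2) => x (b + (q + L : ℕ) + (e : ℕ)))) ?_ ?_ ?_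
  · intro x hx
    exact ⟨hz x hx, Set.mem_univ _⟩
  · intro x hx y hy hxy
    simp only [Prod.mk.injEq] at hxy
    exact eq_of_splice_eq (by omega) hx.1 hy.1 hxy.1 fun e he => congrFun hxy.2 ⟨e, he⟩
  · exact (hfin.sdiff).prod Set.finite_univ

theorem ncard_predicted_le {Q : ℕ} (hQ : 1 ≤ Q) (hwalk : ∀ s t : State, HasWalk Q s t)
    {n : ℕ} {b : ℤ} {q : ℕ} {r : ℕ → ℕ} {g : Spine → Spine} (hq : 1 ≤ q) (l : ℕ)
    (hn : q + (Q + 2) * l ≤ n) (hr : ∀ p, q ≤ p → p < q + (Q + 2) * l → r p < p) :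
    ((predicted n b q ((Q + 2) * l) r g).ncard : ℝ) ≤
      (1 - 1 / (Fintype.card State : ℝ) ^ (Q + 2)) ^ l * (J n).ncard := by
  have hcard : (1 : ℝ) ≤ Fintype.card State := by
    exact_mod_cast Fintype.card_pos_iff.2 ⟨State.A .a⟩
  have hK := one_le_pow₀ hcard (n := Q + 2)
  set K : ℝ := (Fintype.card State : ℝ) ^ (Q + 2) with hKdef
  have hρ : 0 ≤ 1 - 1 / K := by
    rw [sub_nonneg, div_le_one (by positivity)]
    exact hK
  induction l with
  | zero =>
    simp only [pow_zero, one_mul, Nat.cast_le]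
    exact Set.ncard_le_ncard predicted_subset_J (J_finite (by omega))
  | succ l ih =>
    rw [mul_add, mul_one] at hn hr ⊢
    replace ih := ih (by omega) fun p h1 h2 => hr p h1 (by omega)
    have h1 := ncard_predicted_le_mul hQ hwalk (b := b) (g := g) (r := r) hq
      (n := n) (L := (Q + 2) * l) (by omega) (fun p h1 h2 => hr p h1 (by omega))
    have hsub := predicted_anti (n := n) (b := b) (q := q) (r := r) (g := g)
      (Nat.le_add_right ((Q + 2) * l) (Q + 2))
    have hfin : (predicted n b q ((Q + 2) * l) r g).Finite :=
      (J_finite (by omega)).subset predicted_subset_J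
    have h2 := Set.ncard_sdiff_add_ncard_of_subset hsub hfin
    have h1' : ((predicted n b q ((Q + 2) * l) r g).ncard : ℝ) ≤
      (predicted n b q ((Q + 2) * l) r g \ predicted n b q ((Q + 2) * l + (Q + 2)) r g).ncard *
        K := by
      rw [hKdef]
      exact_mod_cast h1
    have h2' : ((predicted n b q ((Q + 2) * l) r g \
        predicted n b q ((Q + 2) * l + (Q + 2)) r g).ncard : ℝ) +
        (predicted n b q ((Q + 2) * l + (Q + 2)) r g).ncard =
        (predicted n b q ((Q + 2) * l) r g).ncard := by exact_mod_cast h2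
    have h3 : ((predicted n b q ((Q + 2) * l) r g).ncard : ℝ) * (1 / K) ≤
        (predicted n b q ((Q + 2) * l) r g \
          predicted n b q ((Q + 2) * l + (Q + 2)) r g).ncard := by
      rw [mul_one_div, div_le_iff₀ (by positivity)]
      exact h1'
    calc ((predicted n b q ((Q + 2) * l + (Q + 2)) r g).ncard : ℝ)
        ≤ (1 - 1 / K) * (predicted n b q ((Q + 2) * l) r g).ncard := by linarith
      _ ≤ (1 - 1 / K) * ((1 - 1 / K) ^ l * (J n).ncard) := by gcongr
      _ = (1 - 1 / K) ^ (l + 1) * (J n).ncard := by ring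

/-! ### From agreement of windows to prediction -/

/-- Agreement of the spines along two windows of length `k` predicts a quarter as many letters. -/
theorem exists_predicted_of_shift {n k i j L : ℕ} (hk : k ≤ n) (hij : i < j) (hj : j < n)
    (hL : L = (k - 2) / 4) : ∃ (b : ℤ) (q : ℕ) (r : ℕ → ℕ) (g : Spine → Spine),
      1 ≤ q ∧ q + L ≤ n ∧ (∀ p, q ≤ p → p < q + L → r p < p) ∧
      ∀ x ∈ J n, (∀ m : ℤ, 1 < m → m < k → spine (x (m + i)) = spine (x (m + j))) →
        x ∈ predicted n b q L r g := by
  -- Prediction goes along the shorter of the two cyclic arcs between `i` and `j`. Its length is at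
  -- most `n / 2`, so `q + L ≤ n`; the windows may overlap, as only `r p < p` matters.
  by_cases h : 2 * (j - i) ≤ n
  · refine ⟨i + 2, j - i, fun p => p - (j - i), id, by omega, by omega,
      fun p _ _ => by beta_reduce; omega, fun x hx hm => ⟨hx, fun p h1 h2 => ?_⟩⟩
    have := hm (p - (j - i : ℕ) + 2) (by omega) (by omega)
    rw [show (p : ℤ) - (j - i : ℕ) + 2 + i = i + 2 + (p - (j - i) : ℕ) by omega,
      show (p : ℤ) - (j - i : ℕ) + 2 + j = i + 2 + p by omega] at this
    exact this.symm
  · refine ⟨j + 2, n - (j - i), fun p => p - (n - (j - i)), id, by omega, by omega,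
      fun p _ _ => by beta_reduce; omega, fun x hx hm => ⟨hx, fun p h1 h2 => ?_⟩⟩
    have := hm (p - (n - (j - i) : ℕ) + 2) (by omega) (by omega)
    rw [show (p : ℤ) - (n - (j - i) : ℕ) + 2 + j = j + 2 + (p - (n - (j - i)) : ℕ) by omega,
      ← eq_of_mem_J hx _ 1,
      show (p : ℤ) - (n - (j - i) : ℕ) + 2 + i + 1 * n = j + 2 + p by omega] at this
    exact this

/-- Agreement of the spine along one window with the inverse of the spine along another one:
some block of a quarter of the length is disjoint from its mirror image. -/
theorem exists_predicted_of_reflection {n k i j L : ℕ} (hn : 1 ≤ n) (hk : k ≤ n)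
    (hL : L = (k - 2) / 4) : ∃ (b : ℤ) (q : ℕ) (r : ℕ → ℕ) (g : Spine → Spine),
      1 ≤ q ∧ q + L ≤ n ∧ (∀ p, q ≤ p → p < q + L → r p < p) ∧
      ∀ x ∈ J n, (∀ m : ℤ, 1 < m → m < k →
          spine (x (m + i)) = (spine (x (k + 1 - m + j))).bar) →
        x ∈ predicted n b q L r g := by
  rcases Nat.eq_zero_or_pos L with hL0 | hLpos
  · exact ⟨0, 1, id, id, le_rfl, by omega, fun p _ _ => by omega,
      fun x hx _ => ⟨hx, fun p _ _ => by omega⟩⟩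
  -- The block `m₀ ≤ m < m₀ + L` is predicted by its mirror image, whose first position is the base
  -- point; `δ` is the offset of the block from there, reduced modulo `n`. The two inequalities on
  -- `δ` say that block and mirror image are disjoint on the cycle.
  have key : ∀ m₀ δ : ℕ, ∀ c : ℤ, 2 ≤ m₀ → m₀ + L ≤ k → L ≤ δ → δ + L ≤ n →
      (2 * m₀ + i + L - 2 - k - j : ℤ) = δ + c * n →
      ∃ (b : ℤ) (q : ℕ) (r : ℕ → ℕ) (g : Spine → Spine),
        1 ≤ q ∧ q + L ≤ n ∧ (∀ p, q ≤ p → p < q + L → r p < p) ∧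
        ∀ x ∈ J n, (∀ m : ℤ, 1 < m → m < k →
            spine (x (m + i)) = (spine (x (k + 1 - m + j))).bar) →
          x ∈ predicted n b q L r g := by
    intro m₀ δ c h1 h2 h3 h4 h5
    refine ⟨k + 2 + j - m₀ - L, δ, fun p => L - 1 + δ - p, Spine.bar, by omega, h4,
      fun p _ _ => by beta_reduce; omega, fun x hx hm => ⟨hx, fun p hp1 hp2 => ?_⟩⟩
    have := hm (m₀ + (p - δ)) (by omega) (by omega)
    rw [show (m₀ : ℤ) + (p - δ) + i = k + 2 + j - m₀ - L + p + c * n by linarith,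
      eq_of_mem_J hx] at this
    rw [this]
    congr 3
    beta_reduce
    omega
  have hn' : (0 : ℤ) < n := by omega
  set t : ℤ := 2 * (2 : ℕ) + i + L - 2 - k - j with ht
  have h0 := Int.emod_nonneg t hn'.ne'
  have h1 := Int.emod_lt_of_pos t hn'
  have h2 := Int.emod_add_mul_ediv t n
  by_cases hδ : (L : ℤ) ≤ t % n ∧ t % n + L ≤ n
  · refine key 2 (t % n).toNat (t / n) le_rfl (by omega) (by omega) (by omega) ?_
    rw [Int.toNat_of_nonneg h0]
    linarith
  -- If the block with `m₀ = 2` meets its mirror image, the next block is used: moving `m₀` by `L`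
  -- changes the offset by `2 * L`, and `4 * L ≤ n` then gives disjointness.
  by_cases hδ' : t % n < L
  · refine key (2 + L) (t % n + 2 * L).toNat (t / n) (by omega) (by omega) (by omega)
      (by omega) ?_
    rw [Int.toNat_of_nonneg (by omega)]
    push_cast at ht ⊢
    linarith
  · refine key (2 + L) (t % n + 2 * L - n).toNat (t / n + 1) (by omega) (by omega) (by omega)
      (by omega) ?_
    rw [Int.toNat_of_nonneg (by omega)]
    push_cast at ht ⊢
    linarith

/-! ### Bounding the kernel and its expectation -/

theorem abs_u_le_one (k : ℕ) (ζ ξ : ℤ → Spine) : |u k ζ ξ| ≤ 1 := by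
  unfold u
  split_ifs <;> simp

theorem eq_of_u_ne_zero {k : ℕ} {ζ ξ : ℤ → Spine} (h : u k ζ ξ ≠ 0) (m : ℤ) (h1 : 1 < m)
    (h2 : m < k) : ζ m = ξ m := by
  unfold u at h
  split_ifs at h with h'
  · exact h'.1.2.2 m h1 h2
  · simp at h

open Classical in
theorem abs_u_le_indicator {k : ℕ} {ζ ξ : ℤ → Spine} {P : Prop}
    (h : (∀ m : ℤ, 1 < m → m < k → ζ m = ξ m) → P) :
    |((u k ζ ξ : ℤ) : ℝ)| ≤ if P then 1 else 0 := by
  by_cases hu : u k ζ ξ = 0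
  · rw [hu]
    split_ifs <;> simp
  · rw [if_pos (h (eq_of_u_ne_zero hu))]
    exact_mod_cast abs_u_le_one k ζ ξ

open Classical in
theorem expect_le_ncard {n : ℕ} (hn : 1 ≤ n) {f : (ℤ → State) → ℝ} {S₁ S₂ : Set (ℤ → State)}
    (h₁ : S₁ ⊆ J n) (h₂ : S₂ ⊆ J n)
    (hf : ∀ x ∈ J n, f x ≤ (if x ∈ S₁ then 1 else 0) + if x ∈ S₂ then 1 else 0) :
    expect n f ≤ (S₁.ncard + S₂.ncard) / (J n).ncard := by
  have hfin := J_finite hn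
  unfold expect
  gcongr
  rw [finsum_mem_eq_finite_toFinset_sum _ hfin]
  have key : ∀ S ⊆ J n, (S.ncard : ℝ) = ∑ x ∈ hfin.toFinset, if x ∈ S then (1 : ℝ) else 0 := by
    intro S hS
    rw [Finset.sum_boole, Set.ncard_eq_toFinset_card S (hfin.subset hS)]
    congr 2
    ext x
    simp only [Set.Finite.mem_toFinset, Finset.mem_filter]
    exact ⟨fun h => ⟨hS h, h⟩, fun h => h.2⟩
  rw [key S₁ h₁, key S₂ h₂, ← Finset.sum_add_distrib]
  exact Finset.sum_le_sum fun x hx => hf x (by simpa using hx)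

theorem exists_pow_div_le {ρ : ℝ} (h0 : 0 ≤ ρ) (h1 : ρ < 1) {T : ℕ} (hT : 1 ≤ T) :
    ∃ C θ : ℝ, 0 < θ ∧ θ < 1 ∧ ∀ k : ℕ, ρ ^ ((k - 2) / 4 / T) ≤ C * θ ^ k := by
  have hT' : (1 : ℝ) ≤ T := by exact_mod_cast hT
  -- Chosen so that Bernoulli's inequality gives `(1 - η) ^ (4 * T) ≥ 1 - 4 * T * η = ρ`.
  set η : ℝ := (1 - ρ) / (4 * T) with hη
  have hη0 : 0 < η := div_pos (by linarith) (by positivity)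
  have hη1 : η < 1 := by
    rw [hη, div_lt_one (by positivity)]
    linarith
  have hpow : ρ ≤ (1 - η) ^ (4 * T) := by
    have := one_add_mul_le_pow (a := -η) (by linarith) (4 * T)
    have h2 : (4 * T : ℝ) * η = 1 - ρ := by
      rw [hη]
      field_simp
    push_cast at this
    rw [← sub_eq_add_neg] at this
    linarith
  have hθ : 0 < 1 - η := by linarith
  -- The constant absorbs the loss from the truncated subtraction and the two floor divisions.
  refine ⟨((1 - η) ^ (4 * T + 2))⁻¹, 1 - η, hθ, by linarith, fun k => ?_⟩
  set l := (k - 2) / 4 / T with hl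
  have hkl : k ≤ 4 * T * l + (4 * T + 2) := by
    have h2 := Nat.lt_mul_div_succ ((k - 2) / 4) (show 0 < T by omega)
    rw [← hl, mul_add, mul_one] at h2
    have h3 : 4 * T * l = 4 * (T * l) := mul_assoc _ _ _
    omega
  rw [inv_mul_eq_div, le_div_iff₀ (by positivity)]
  calc ρ ^ l * (1 - η) ^ (4 * T + 2)
      ≤ ((1 - η) ^ (4 * T)) ^ l * (1 - η) ^ (4 * T + 2) := by gcongr
    _ = (1 - η) ^ (4 * T * l + (4 * T + 2)) := by rw [← pow_mul, ← pow_add]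
    _ ≤ (1 - η) ^ k := pow_le_pow_of_le_one hθ.le (by linarith) hkl

end Snake

theorem mainTheorem8 :
    ∃ C θ : ℝ, 0 < θ ∧ θ < 1 ∧
      ∀ n k i j : ℕ, 1 ≤ k → k ≤ n → i < j → j < n →
        Snake.expect n
          (fun x => |((Snake.h k (Snake.shift i x) (Snake.shift j x) : ℤ) : ℝ)|) ≤ C * θ ^ k := by
  classical
  obtain ⟨Q, hQ, hwalk⟩ := Snake.exists_forall_hasWalk
  have hcard : (1 : ℝ) ≤ Fintype.card Snake.State := by
    exact_mod_cast Fintype.card_pos_iff.2 ⟨Snake.State.A .a⟩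
  have hK := one_le_pow₀ hcard (n := Q + 2)
  set ρ : ℝ := 1 - 1 / (Fintype.card Snake.State : ℝ) ^ (Q + 2) with hρ
  have hρ0 : 0 ≤ ρ := by
    rw [hρ, sub_nonneg, div_le_one (by positivity)]
    exact hK
  have hρ1 : ρ < 1 := by
    have : 0 < 1 / (Fintype.card Snake.State : ℝ) ^ (Q + 2) := by positivity
    linarith
  obtain ⟨C, θ, hθ0, hθ1, hC⟩ := Snake.exists_pow_div_le hρ0 hρ1 (show 1 ≤ Q + 2 by omega)
  -- One `C` for the term `u` (shift) and one for `v` (reflection).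
  refine ⟨2 * C, θ, hθ0, hθ1, fun n k i j hk hkn hij hjn => ?_⟩
  have hn : 1 ≤ n := hk.trans hkn
  set l := (k - 2) / 4 / (Q + 2) with hl
  have hlL : (Q + 2) * l ≤ (k - 2) / 4 := Nat.mul_div_le _ _
  obtain ⟨b₁, q₁, r₁, g₁, hq₁, hqn₁, hr₁, hu⟩ :=
    Snake.exists_predicted_of_shift hkn hij hjn rfl
  obtain ⟨b₂, q₂, r₂, g₂, hq₂, hqn₂, hr₂, hv⟩ :=
    Snake.exists_predicted_of_reflection (i := i) (j := j) hn hkn rfl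
  have hJ : (0 : ℝ) < (Snake.J n).ncard := by
    exact_mod_cast (Set.ncard_pos (Snake.J_finite hn)).2 (Snake.J_nonempty n)
  have hc₁ := Snake.ncard_predicted_le hQ hwalk (b := b₁) (g := g₁) (n := n) hq₁ l
    (by omega) (r := r₁) (fun p h1 h2 => hr₁ p h1 (by omega))
  have hc₂ := Snake.ncard_predicted_le hQ hwalk (b := b₂) (g := g₂) (n := n) hq₂ l
    (by omega) (r := r₂) (fun p h1 h2 => hr₂ p h1 (by omega))
  refine (Snake.expect_le_ncard hn (Snake.predicted_subset_J (b := b₁) (q := q₁)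
    (L := (Q + 2) * l) (r := r₁) (g := g₁)) (Snake.predicted_subset_J (b := b₂) (q := q₂)
    (L := (Q + 2) * l) (r := r₂) (g := g₂)) fun x hx => ?_).trans ?_
  · rw [Snake.h, Int.cast_add]
    refine (abs_add_le _ _).trans (add_le_add ?_ ?_)
    · exact Snake.abs_u_le_indicator fun hm => Snake.predicted_anti hlL (hu x hx hm)
    · exact Snake.abs_u_le_indicator fun hm => Snake.predicted_anti hlL (hv x hx hm)
  · rw [div_le_iff₀ hJ]
    have := mul_le_mul_of_nonneg_right (hC k) hJ.le
    linarith
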